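/- Let $n\ge 0$ be an integer, $A\in\mathbb{R}^{n\times n}$, and for $b\in\mathbb{R}^n$ consider the absolute value equation $Ax-|x|=b$, where $|x|$ is the componentwise absolute value. Let $D(x)=\mathrm{diag}(\mathrm{sign}(x))$, where $\mathrm{sign}(x)$ has the components $1,0,-1$ according to the signs of the components of $x$. The generalized Newton method (GNM) started at $x^0\in\mathbb{R}^n$ is the iteration $x^{i+1}=(A-D(x^i))^{-1}b$, $i=0,1,\ldots$; it is well defined if every $A-D(x^i)$ is nonsingular. A real square matrix with nonpositive off-diagonal entries, written as $sI-B$ with $B\ge 0$ entrywise, is a nonsingular $M$-matrix if $s>\rho(B)$ and a singular $M$-matrix if $s=\rho(B)$, where $\rho$ is the spectral radius. A matrix $M$ is irreducible if there is no permutation matrix $P$ for which $P^TMP=\begin{bmatrix}M_{11}&M_{12}\\0&M_{22}\end{bmatrix}$ with square diagonal blocks of positive sizes. (1) If $A-I$ is a nonsingular $M$-matrix, then for all $b,x^0\in\mathbb{R}^n$, GNM is well defined and converges to an exact solution of $Ax-|x|=b$ in at most $n+2$ iterations; that is, for some $k\le n+2$ the iterate $x^k$ is a solution and $x^i=x^k$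 for all $i\ge k$. (2) If $A-I$ is an irreducible singular $M$-matrix, then there is a vector $v>0$ (all components positive) with $(A^T-I)v=0$, and every solution $w\in\mathbb{R}^n$ of $(A^T-I)w=0$ is a scalar multiple of $v$. For any such $v>0$, any $b$ with $v^Tb<0$ and any $x^0$ with $D(x^0)\ne I$, GNM is well defined and converges to an exact solution of $Ax-|x|=b$ in at most $n+1$ iterations, in the same sense. -/

import Mathlib

namespace AVE

/-- The spectral radius of a real square matrix: the largest modulus of its complex eigenvalues. -/
noncomputable def specRadius {n : ℕ} (B : Matrix (Fin n) (Fin n) ℝ) : ℝ :=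
  (spectralRadius ℂ (B.map Complex.ofReal)).toReal

/-- `Z`-matrix: all off-diagonal entries are nonpositive. -/
def IsZMatrix {n : ℕ} (A : Matrix (Fin n) (Fin n) ℝ) : Prop :=
  ∀ i j, i ≠ j → A i j ≤ 0

/-- Nonsingular `M`-matrix: a `Z`-matrix of the form `s I - B` with `B ≥ 0` and `s > ρ(B)`. -/
def IsNonsingularMMatrix {n : ℕ} (A : Matrix (Fin n) (Fin n) ℝ) : Prop :=
  IsZMatrix A ∧ ∃ (s : ℝ) (B : Matrix (Fin n) (Fin n) ℝ),
    (∀ i j, 0 ≤ B i j) ∧ A = s • (1 : Matrix (Fin n) (Fin n) ℝ) - B ∧ specRadius B < s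

/-- Singular `M`-matrix: a `Z`-matrix of the form `s I - B` with `B ≥ 0` and `s = ρ(B)`. -/
def IsSingularMMatrix {n : ℕ} (A : Matrix (Fin n) (Fin n) ℝ) : Prop :=
  IsZMatrix A ∧ ∃ (s : ℝ) (B : Matrix (Fin n) (Fin n) ℝ),
    (∀ i j, 0 ≤ B i j) ∧ A = s • (1 : Matrix (Fin n) (Fin n) ℝ) - B ∧ s = specRadius B

/-- Reducible matrix: some simultaneous permutation of rows and columns
(that is, `Pᵀ A P` for a permutation matrix `P`) has a zero lower left block, the two diagonal
blocks being square of positive sizes `r` and `n - r`. -/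
def IsReducible {n : ℕ} (A : Matrix (Fin n) (Fin n) ℝ) : Prop :=
  ∃ (σ : Equiv.Perm (Fin n)) (r : ℕ), 0 < r ∧ r < n ∧
    ∀ i j : Fin n, r ≤ (i : ℕ) → (j : ℕ) < r → A.submatrix σ σ i j = 0

/-- Irreducible matrix: one that is not reducible. -/
def IsIrreducible {n : ℕ} (A : Matrix (Fin n) (Fin n) ℝ) : Prop :=
  ¬ IsReducible A

/-- The generalized Jacobian `D(x) = diag (sign x)` of `|x|`. -/
noncomputable def signDiag {n : ℕ} (x : Fin n → ℝ) : Matrix (Fin n) (Fin n) ℝ :=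
  Matrix.diagonal fun i => Real.sign (x i)

/-- `x` is an exact solution of the absolute value equation `A x - |x| = b`. -/
def IsSolution {n : ℕ} (A : Matrix (Fin n) (Fin n) ℝ) (b x : Fin n → ℝ) : Prop :=
  A.mulVec x - (fun i => |x i|) = b

/-- The iterates of the generalized Newton method, `x^{i+1} = (A - D(x^i))⁻¹ b`.
They are meaningful as long as all the matrices `A - D(x^i)` are nonsingular. -/
noncomputable def gnm {n : ℕ} (A : Matrix (Fin n) (Fin n) ℝ) (b x₀ : Fin n → ℝ) :
    ℕ → Fin n → ℝ
  | 0 => x₀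
  | i + 1 => (A - signDiag (gnm A b x₀ i))⁻¹.mulVec b

/-- The generalized Newton method started at `x₀` is well defined at every step and converges to
an exact solution in at most `N` iterations: some iterate `x^k` with `k ≤ N` is an exact solution
and all later iterates are equal to it. -/
def GNMTerminatesWithin {n : ℕ} (A : Matrix (Fin n) (Fin n) ℝ) (b x₀ : Fin n → ℝ)
    (N : ℕ) : Prop :=
  (∀ i, IsUnit (A - signDiag (gnm A b x₀ i))) ∧
    ∃ k ≤ N, IsSolution A b (gnm A b x₀ k) ∧ ∀ i ≥ k, gnm A b x₀ i = gnm A b x₀ k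

end AVE

/-!
The argument rests on inverse positivity: `N x ≥ 0` implies `x ≥ 0`.

If every matrix `A - D(xᵏ)` is inverse positive, then `D(x) y ≤ |y|` gives
`(A - D(xᵏ⁺¹)) xᵏ⁺¹ ≤ b = (A - D(xᵏ⁺¹)) xᵏ⁺²`, so the iterates increase from `x¹` on. For such an
increasing sequence, an iterate `xᵏ⁺²` that is not a solution has a positive component at a place
where `xᵏ⁺¹` has none. The set of positive components therefore grows strictly until a solution is
reached, and a bound on its size bounds the number of iterations
(`gnmTerminatesWithin_of_inversePositive`). The size is at most `n` in general, and at most `n - 1`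
in the singular case: `vᵀ(A - I) = 0` and `vᵀb < 0` give `vᵀ(I - D(xᵏ)) xᵏ⁺¹ < 0`, so that some
component of `xᵏ⁺¹` is negative.

Inverse positivity of `A - D(x) = (A - I) + (I - D(x))` comes from a positive row vector `v` with
`vᵀ(A - D(x)) ≥ 0` (`inversePositive_of_vecMul_nonneg`). In the nonsingular case `v` can be chosen
with `vᵀ(A - I)` positive: Gelfand's formula shows that `s I - B` is inverse positive for
`s > ρ(B)`, and the column sums of its inverse serve as `v`. In the singular case `v` is the Perron
vector. It is found by maximizing the smallest component of `vᵀ(A - I)` over the standard simplex.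
The maximum is nonnegative, by the nonsingular case applied to `A - I + ε I`. A maximizer with
`vᵀ(A - I) ≠ 0` would make `A - I` inverse positive, which contradicts `(A - I)|y| ≤ 0` for an
eigenvector `y` of `B` to an eigenvalue of modulus `ρ(B)`.
-/

namespace AVE

open Matrix Filter Topology

variable {n : ℕ}

/-- A square matrix is inverse positive (also called monotone) if `N x ≥ 0` implies `x ≥ 0`.
Such a matrix is nonsingular and its inverse is entrywise nonnegative. -/
def InversePositive (N : Matrix (Fin n) (Fin n) ℝ) : Prop :=
  ∀ x : Fin n → ℝ, (∀ i, 0 ≤ (N *ᵥ x) i) → ∀ i, 0 ≤ x i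

/-! ### Inverse positive matrices -/

namespace InversePositive

variable {N : Matrix (Fin n) (Fin n) ℝ}

lemma le_of_mulVec_le (h : InversePositive N) {x y : Fin n → ℝ}
    (hxy : ∀ i, (N *ᵥ x) i ≤ (N *ᵥ y) i) (i : Fin n) : x i ≤ y i := by
  have := h (y - x) (fun i => by rw [mulVec_sub]; simpa using hxy i) i
  simpa using this

lemma isUnit (h : InversePositive N) : IsUnit N := by
  rw [← mulVec_injective_iff_isUnit]
  intro x y hxy
  have hxy' : N *ᵥ x = N *ᵥ y := hxy
  funext i
  exact le_antisymm (h.le_of_mulVec_le (fun i => by rw [hxy']) i)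
    (h.le_of_mulVec_le (fun i => by rw [hxy']) i)

lemma mulVec_inv_mulVec (h : InversePositive N) (b : Fin n → ℝ) : N *ᵥ (N⁻¹ *ᵥ b) = b := by
  rw [mulVec_mulVec, mul_nonsing_inv _ ((isUnit_iff_isUnit_det N).1 h.isUnit), one_mulVec]

lemma inv_nonneg (h : InversePositive N) (i j : Fin n) : 0 ≤ N⁻¹ i j := by
  have := h (N⁻¹ *ᵥ Pi.single j 1) (fun k => by
    rw [h.mulVec_inv_mulVec]
    exact (Pi.single_nonneg.2 zero_le_one : (0 : Fin n → ℝ) ≤ Pi.single j 1) k) i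
  simpa using this

/-- The column sums of the inverse of an inverse positive `Z`-matrix form a positive row vector
which the matrix takes to the vector of ones. -/
lemma exists_pos_vecMul_eq_one (h : InversePositive N) (hZ : IsZMatrix N) :
    ∃ u : Fin n → ℝ, (∀ i, 0 < u i) ∧ u ᵥ* N = 1 := by
  have hu : (1 ᵥ* N⁻¹) ᵥ* N = 1 := by
    rw [vecMul_vecMul, nonsing_inv_mul _ ((isUnit_iff_isUnit_det N).1 h.isUnit), vecMul_one]
  have h0 : ∀ i, 0 ≤ (1 ᵥ* N⁻¹ : Fin n → ℝ) i := fun i => by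
    simp only [vecMul, dotProduct]
    exact Finset.sum_nonneg fun j _ => mul_nonneg zero_le_one (h.inv_nonneg j i)
  refine ⟨1 ᵥ* N⁻¹, fun j => (h0 j).lt_of_ne' fun hj => ?_, hu⟩
  have hle : ((1 ᵥ* N⁻¹) ᵥ* N) j ≤ 0 := by
    rw [vecMul, dotProduct]
    refine Finset.sum_nonpos fun i _ => ?_
    by_cases hij : i = j
    · rw [hij, hj, zero_mul]
    · exact mul_nonpos_of_nonneg_of_nonpos (h0 i) (hZ i j hij)
  rw [hu] at hle
  exact absurd hle (by simp)

end InversePositive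

/-- A `Z`-matrix with a positive row vector `v` such that `vᵀN ≥ 0` is inverse positive, provided
that every nonempty index set `S` contains an index `j` with `(vᵀN)ⱼ > 0` or with a nonzero entry of
column `j` outside `S`. If `N x ≥ 0`, the rows in `S = {j | xⱼ < 0}`, weighted by `v`, have a
nonnegative sum, whereas each `xⱼ` enters that sum with a nonpositive contribution. -/
lemma inversePositive_of_vecMul_nonneg {N : Matrix (Fin n) (Fin n) ℝ} (hZ : IsZMatrix N)
    {v : Fin n → ℝ} (hv : ∀ i, 0 < v i) (h0 : ∀ j, 0 ≤ (v ᵥ* N) j)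
    (hS : ∀ S : Finset (Fin n), S.Nonempty →
      ∃ j ∈ S, 0 < (v ᵥ* N) j ∨ ∃ i ∉ S, N i j ≠ 0) :
    InversePositive N := by
  intro x hx
  by_contra! hneg
  obtain ⟨j₀, hj₀⟩ := hneg
  let S : Finset (Fin n) := Finset.univ.filter fun j => x j < 0
  have memS : ∀ j, j ∈ S ↔ x j < 0 := fun j => by simp [S]
  let c : Fin n → ℝ := fun j => ∑ i ∈ S, v i * N i j
  have hsplit : ∀ j, c j + ∑ i ∈ Sᶜ, v i * N i j = (v ᵥ* N) j := fun j =>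
    Finset.sum_add_sum_compl S _
  have hrest : ∀ j ∈ S, ∀ i ∈ Sᶜ, v i * N i j ≤ 0 := fun j hj i hi =>
    mul_nonpos_of_nonneg_of_nonpos (hv i).le
      (hZ i j fun e => Finset.mem_compl.1 hi (e ▸ hj))
  have hterm : ∀ j, c j * x j ≤ 0 := by
    intro j
    by_cases hj : j ∈ S
    · have := Finset.sum_nonpos (hrest j hj)
      exact mul_nonpos_of_nonneg_of_nonpos (by linarith [hsplit j, h0 j]) ((memS j).1 hj).le
    · refine mul_nonpos_of_nonpos_of_nonneg (Finset.sum_nonpos fun i hi => ?_)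
        (not_lt.1 fun h => hj ((memS j).2 h))
      exact mul_nonpos_of_nonneg_of_nonpos (hv i).le (hZ i j fun e => hj (e ▸ hi))
  have hstrict : ∃ j, c j * x j < 0 := by
    obtain ⟨j, hj, hpos⟩ := hS S ⟨j₀, (memS j₀).2 hj₀⟩
    refine ⟨j, mul_neg_of_pos_of_neg ?_ ((memS j).1 hj)⟩
    rcases hpos with hpos | ⟨i, hi, hij⟩
    · linarith [hsplit j, Finset.sum_nonpos (hrest j hj)]
    · have hne : i ≠ j := fun e => hi (e ▸ hj)
      have : ∑ i ∈ Sᶜ, v i * N i j < 0 :=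
        Finset.sum_neg' (hrest j hj)
          ⟨i, Finset.mem_compl.2 hi, mul_neg_of_pos_of_neg (hv i) ((hZ i j hne).lt_of_ne hij)⟩
      linarith [hsplit j, h0 j]
  have hsum : ∑ j, c j * x j = ∑ i ∈ S, v i * (N *ᵥ x) i := by
    simp only [c, mulVec, dotProduct, Finset.sum_mul, Finset.mul_sum]
    rw [Finset.sum_comm]
    exact Finset.sum_congr rfl fun i _ => Finset.sum_congr rfl fun j _ => by ring
  have h1 : 0 ≤ ∑ i ∈ S, v i * (N *ᵥ x) i :=
    Finset.sum_nonneg fun i _ => mul_nonneg (hv i).le (hx i)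
  obtain ⟨j, hj⟩ := hstrict
  have h2 : ∑ j, c j * x j < 0 :=
    Finset.sum_neg' (fun j _ => hterm j) ⟨j, Finset.mem_univ j, hj⟩
  linarith

/-! ### Irreducible matrices -/

/-- Otherwise a permutation taking the first `S.card` indices to `S` would put the matrix in reduced
block form. -/
lemma IsIrreducible.exists_ne_zero {N : Matrix (Fin n) (Fin n) ℝ} (h : IsIrreducible N)
    {S : Finset (Fin n)} (hS : S.Nonempty) (hS' : S ≠ Finset.univ) :
    ∃ j ∈ S, ∃ i ∉ S, N i j ≠ 0 := by
  by_contra! hcon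
  have hlt : S.card < n := by
    simpa using Finset.card_lt_card (Finset.ssubset_univ_iff.2 hS')
  have hcard : Fintype.card {j : Fin n // (j : ℕ) < S.card} = Fintype.card {j // j ∈ S} := by
    rw [Fintype.card_subtype, Fintype.card_coe]
    simp [Fin.card_filter_val_lt, hlt.le]
  let e := Fintype.equivOfCardEq hcard
  refine h ⟨e.extendSubtype, S.card, hS.card_pos, hlt, fun i j hi hj => ?_⟩
  exact hcon _ (e.extendSubtype_mem j hj) _ (e.extendSubtype_not_mem i (not_lt.2 hi))

lemma IsIrreducible.pos_of_vecMul_nonneg {N : Matrix (Fin n) (Fin n) ℝ} (h : IsIrreducible N)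
    (hZ : IsZMatrix N) {v : Fin n → ℝ} (h0 : ∀ i, 0 ≤ v i) (hne : v ≠ 0)
    (hN : ∀ j, 0 ≤ (v ᵥ* N) j) (i : Fin n) : 0 < v i := by
  by_contra hi
  let S : Finset (Fin n) := Finset.univ.filter fun j => v j = 0
  have memS : ∀ j, j ∈ S ↔ v j = 0 := fun j => by simp [S]
  obtain ⟨j, hj, k, hk, hkj⟩ := h.exists_ne_zero (S := S)
    ⟨i, (memS i).2 (le_antisymm (not_lt.1 hi) (h0 i))⟩
    (fun hu => hne (funext fun j => (memS j).1 (hu ▸ Finset.mem_univ j)))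
  have hvj := (memS j).1 hj
  have hvk : 0 < v k := (h0 k).lt_of_ne' fun e => hk ((memS k).2 e)
  have hlt : (v ᵥ* N) j < 0 := by
    refine Finset.sum_neg' (fun l _ => ?_) ⟨k, Finset.mem_univ k,
      mul_neg_of_pos_of_neg hvk ((hZ k j fun e => hk (e ▸ hj)).lt_of_ne hkj)⟩
    by_cases hl : l = j
    · simp [hl, hvj]
    · exact mul_nonpos_of_nonneg_of_nonpos (h0 l) (hZ l j hl)
  exact absurd (hN j) (not_le.2 hlt)

/-- The left kernel of an irreducible `Z`-matrix is spanned by any positive vector in it: subtract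
the largest multiple of `v` that keeps `w` nonnegative. -/
lemma IsIrreducible.exists_eq_smul {N : Matrix (Fin n) (Fin n) ℝ} (h : IsIrreducible N)
    (hZ : IsZMatrix N) {v w : Fin n → ℝ} (hv : ∀ i, 0 < v i) (hvN : v ᵥ* N = 0)
    (hwN : w ᵥ* N = 0) : ∃ c : ℝ, w = c • v := by
  rcases isEmpty_or_nonempty (Fin n) with hn | hn
  · exact ⟨0, Subsingleton.elim _ _⟩
  obtain ⟨i, hi⟩ := Finite.exists_min fun i => w i / v i
  refine ⟨w i / v i, sub_eq_zero.1 ?_⟩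
  by_contra hne
  refine (h.pos_of_vecMul_nonneg hZ (fun j => ?_) hne (fun j => ?_) i).ne' ?_
  · have := (le_div_iff₀ (hv j)).1 (hi j)
    simpa using this
  · simp [sub_vecMul, smul_vecMul, hvN, hwN]
  · simp [div_mul_cancel₀ _ (hv i).ne']

/-! ### Spectral radius of a nonnegative matrix -/

section Spectral

attribute [local instance] Matrix.linftyOpNormedRing Matrix.linftyOpNormedAlgebra

/-- The spectral radius is finite, so that no junk value of `toReal` enters `specRadius`, and it is
attained in the spectrum. -/
lemma exists_mem_spectrum_norm_eq [Nonempty (Fin n)] (B : Matrix (Fin n) (Fin n) ℝ) :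
    spectralRadius ℂ (B.map Complex.ofReal) = ENNReal.ofReal (specRadius B) ∧
      ∃ z ∈ spectrum ℂ (B.map Complex.ofReal), ‖z‖ = specRadius B := by
  have : CompleteSpace (Matrix (Fin n) (Fin n) ℂ) := FiniteDimensional.complete ℂ _
  obtain ⟨z, hz, h⟩ := spectrum.exists_nnnorm_eq_spectralRadius (B.map Complex.ofReal)
  have hs : specRadius B = ‖z‖ := by
    rw [specRadius, ← h]
    simp
  refine ⟨?_, z, hz, hs.symm⟩
  rw [hs, ← h, ofReal_norm]
  rfl

/-- Upper half of Gelfand's formula, applied to a vector: `Bᵏ x = O(tᵏ)` for `t > ρ(B)`. -/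
lemma eventually_abs_pow_mulVec_le [Nonempty (Fin n)] (B : Matrix (Fin n) (Fin n) ℝ) {t : ℝ}
    (ht : specRadius B < t) (x : Fin n → ℝ) (i : Fin n) :
    ∀ᶠ k : ℕ in atTop, |(B ^ k *ᵥ x) i| ≤ t ^ k * ‖fun j => (x j : ℂ)‖ := by
  have : CompleteSpace (Matrix (Fin n) (Fin n) ℂ) := FiniteDimensional.complete ℂ _
  have hρ : 0 ≤ specRadius B := ENNReal.toReal_nonneg
  have hG := spectrum.pow_norm_pow_one_div_tendsto_nhds_spectralRadius (B.map Complex.ofReal)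
  rw [(exists_mem_spectrum_norm_eq B).1] at hG
  have hlt : ENNReal.ofReal (specRadius B) < ENNReal.ofReal t :=
    (ENNReal.ofReal_lt_ofReal_iff (hρ.trans_lt ht)).2 ht
  filter_upwards [hG.eventually_lt_const hlt, eventually_ne_atTop 0] with k hk hk0
  rw [ENNReal.ofReal_lt_ofReal_iff (hρ.trans_lt ht), one_div] at hk
  have hpow : ‖(B.map Complex.ofReal) ^ k‖ ≤ t ^ k := by
    rw [← Real.rpow_inv_natCast_pow (norm_nonneg ((B.map Complex.ofReal) ^ k)) hk0]
    exact pow_le_pow_left₀ (by positivity) hk.le k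
  have hmap : (B.map Complex.ofReal) ^ k = (B ^ k).map Complex.ofReal :=
    (map_pow (Complex.ofRealHom.mapMatrix : Matrix (Fin n) (Fin n) ℝ →+* _) B k).symm
  have hc : (((B ^ k *ᵥ x) i : ℝ) : ℂ) =
      ((B.map Complex.ofReal) ^ k *ᵥ fun j => (x j : ℂ)) i := by
    rw [hmap]
    simp [mulVec, dotProduct]
  calc |(B ^ k *ᵥ x) i| = ‖(((B ^ k *ᵥ x) i : ℝ) : ℂ)‖ := by simp
    _ ≤ ‖(B.map Complex.ofReal) ^ k *ᵥ fun j => (x j : ℂ)‖ := by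
      rw [hc]
      exact norm_le_pi_norm _ i
    _ ≤ ‖(B.map Complex.ofReal) ^ k‖ * ‖fun j => (x j : ℂ)‖ := linfty_opNorm_mulVec _ _
    _ ≤ _ := by gcongr

end Spectral

lemma mulVec_mono {B : Matrix (Fin n) (Fin n) ℝ} (hB : ∀ i j, 0 ≤ B i j) {x y : Fin n → ℝ}
    (h : ∀ i, x i ≤ y i) (i : Fin n) : (B *ᵥ x) i ≤ (B *ᵥ y) i := by
  simp only [mulVec, dotProduct]
  exact Finset.sum_le_sum fun j _ => mul_le_mul_of_nonneg_left (h j) (hB i j)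

/-- For `B ≥ 0` and `s > ρ(B)`, the matrix `s I - B` is inverse positive: `s x ≥ B x` gives
`sᵏ x ≥ Bᵏ x`, and `Bᵏ x / sᵏ` tends to zero. -/
lemma inversePositive_smul_one_sub {B : Matrix (Fin n) (Fin n) ℝ} (hB : ∀ i j, 0 ≤ B i j) {s : ℝ}
    (hs : specRadius B < s) : InversePositive (s • (1 : Matrix (Fin n) (Fin n) ℝ) - B) := by
  intro x hx i
  have : Nonempty (Fin n) := ⟨i⟩
  have hρ : 0 ≤ specRadius B := ENNReal.toReal_nonneg
  have hs0 : 0 < s := hρ.trans_lt hs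
  have hx' : ∀ j, (B *ᵥ x) j ≤ s * x j := fun j => by
    simpa [sub_mulVec, smul_mulVec] using hx j
  have hpow : ∀ (k : ℕ) (j : Fin n), (B ^ k *ᵥ x) j ≤ s ^ k * x j := by
    intro k
    induction k with
    | zero => simp
    | succ k ih =>
      intro j
      calc (B ^ (k + 1) *ᵥ x) j = (B *ᵥ (B ^ k *ᵥ x)) j := by rw [mulVec_mulVec, pow_succ']
        _ ≤ (B *ᵥ (s ^ k • x)) j := mulVec_mono hB (by simpa using ih) j
        _ = s ^ k * (B *ᵥ x) j := by simp [mulVec_smul]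
        _ ≤ s ^ k * (s * x j) := by gcongr; exact hx' j
        _ = s ^ (k + 1) * x j := by ring
  obtain ⟨t, ht, hts⟩ := exists_between hs
  have hlim : Tendsto (fun k : ℕ => -((t / s) ^ k * ‖fun j => (x j : ℂ)‖)) atTop (𝓝 0) := by
    have := (tendsto_pow_atTop_nhds_zero_of_lt_one
      (div_nonneg (hρ.trans ht.le) hs0.le) ((div_lt_one hs0).2 hts)).mul_const
      ‖fun j => (x j : ℂ)‖
    simpa using this.neg
  refine le_of_tendsto hlim ?_
  filter_upwards [eventually_abs_pow_mulVec_le B ht x i] with k hk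
  have h1 : -(t ^ k * ‖fun j => (x j : ℂ)‖) ≤ s ^ k * x i :=
    (neg_le_of_abs_le hk).trans (hpow k i)
  rw [div_pow, div_mul_eq_mul_div, ← neg_div, div_le_iff₀ (pow_pos hs0 k)]
  linarith

/-- At the spectral radius inverse positivity is lost: an eigenvector `y` of `B` to an eigenvalue
of modulus `ρ(B)` satisfies `(ρ(B) I - B)|y| ≤ 0`. -/
lemma not_inversePositive_specRadius_smul_one_sub [Nonempty (Fin n)]
    {B : Matrix (Fin n) (Fin n) ℝ} (hB : ∀ i j, 0 ≤ B i j) :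
    ¬ InversePositive (specRadius B • (1 : Matrix (Fin n) (Fin n) ℝ) - B) := by
  intro h
  obtain ⟨-, z, hz, hzρ⟩ := exists_mem_spectrum_norm_eq B
  have hdet : (algebraMap ℂ (Matrix (Fin n) (Fin n) ℂ) z - B.map Complex.ofReal).det = 0 := by
    rw [spectrum.mem_iff, isUnit_iff_isUnit_det, isUnit_iff_ne_zero, not_not] at hz
    exact hz
  obtain ⟨y, hy0, hy⟩ := exists_mulVec_eq_zero_iff.2 hdet
  have hy' : ∀ i, z * y i = ∑ j, (B i j : ℂ) * y j := by
    intro i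
    have := congrFun hy i
    rw [sub_mulVec, Algebra.algebraMap_eq_smul_one, smul_mulVec, one_mulVec] at this
    simpa [mulVec, dotProduct, sub_eq_zero] using this
  refine hy0 (funext fun i => norm_le_zero_iff.1 ?_)
  have := h (fun j => -‖y j‖) (fun i => ?_) i
  · simpa using this
  have h1 : specRadius B * ‖y i‖ ≤ ∑ j, B i j * ‖y j‖ := by
    rw [← hzρ, ← norm_mul, hy' i]
    refine (norm_sum_le _ _).trans (Finset.sum_le_sum fun j _ => ?_)
    rw [norm_mul, Complex.norm_of_nonneg (hB i j)]
  rw [sub_mulVec, smul_mulVec, one_mulVec]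
  simpa [mulVec, dotProduct] using h1

/-! ### The Perron vector of an irreducible singular `M`-matrix -/

/-- A maximizer `v` of the smallest component of `vᵀM` over the simplex works. Since `M + ε I` is a
nonsingular `M`-matrix for every `ε > 0`, some `w` in the simplex has `wᵀM ≥ -ε`. -/
lemma IsSingularMMatrix.exists_mem_stdSimplex {M : Matrix (Fin n) (Fin n) ℝ}
    [Nonempty (Fin n)] (h : IsSingularMMatrix M) :
    ∃ v ∈ stdSimplex ℝ (Fin n), ∀ j, 0 ≤ (v ᵥ* M) j := by
  obtain ⟨hZ, s, B, hB, hM, hs⟩ := h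
  let f : (Fin n → ℝ) → ℝ := fun v => Finset.univ.inf' Finset.univ_nonempty fun j => (v ᵥ* M) j
  have hf : Continuous f := Continuous.finset_inf'_apply _ fun j _ => by
    simp only [vecMul, dotProduct]
    fun_prop
  obtain ⟨v, hv, hmax⟩ := (isCompact_stdSimplex ℝ (Fin n)).exists_isMaxOn
    ⟨_, single_mem_stdSimplex ℝ (Classical.arbitrary (Fin n))⟩ hf.continuousOn
  suffices hfv : 0 ≤ f v from
    ⟨v, hv, fun j => hfv.trans (Finset.inf'_le _ (Finset.mem_univ j))⟩
  refine le_of_forall_pos_le_add fun ε hε => ?_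
  have hMε : M + ε • (1 : Matrix (Fin n) (Fin n) ℝ) = (s + ε) • 1 - B := by
    rw [hM, add_smul]
    abel
  have hZε : IsZMatrix (M + ε • (1 : Matrix (Fin n) (Fin n) ℝ)) := fun i j hij => by
    simpa [one_apply_ne hij] using hZ i j hij
  have hip : InversePositive (M + ε • (1 : Matrix (Fin n) (Fin n) ℝ)) := by
    rw [hMε]
    exact inversePositive_smul_one_sub hB (by linarith)
  obtain ⟨u, hu, huM⟩ := hip.exists_pos_vecMul_eq_one hZε
  have hsum : 0 < ∑ i, u i := Finset.sum_pos (fun i _ => hu i) Finset.univ_nonempty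
  let w : Fin n → ℝ := (∑ i, u i)⁻¹ • u
  have hw : w ∈ stdSimplex ℝ (Fin n) := by
    refine ⟨fun i => mul_nonneg (inv_nonneg.2 hsum.le) (hu i).le, ?_⟩
    simp only [w, Pi.smul_apply, smul_eq_mul, ← Finset.mul_sum]
    exact inv_mul_cancel₀ hsum.ne'
  have hfw : -ε ≤ f w := by
    refine Finset.le_inf' _ _ fun j _ => ?_
    have h1 : (w ᵥ* M) j + ε * w j = (∑ i, u i)⁻¹ := by
      have := congrFun (congrArg ((∑ i, u i)⁻¹ • ·) huM) j
      rw [← smul_vecMul, vecMul_add, vecMul_smul, vecMul_one] at this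
      simpa [w] using this
    have h2 : ε * w j ≤ ε * 1 :=
      mul_le_mul_of_nonneg_left (mem_Icc_of_mem_stdSimplex hw j).2 hε.le
    linarith [inv_pos.2 hsum]
  linarith [show f w ≤ f v from hmax hw]

lemma IsSingularMMatrix.exists_pos_vecMul_eq_zero {M : Matrix (Fin n) (Fin n) ℝ}
    (h : IsSingularMMatrix M) (hirr : IsIrreducible M) :
    ∃ v : Fin n → ℝ, (∀ i, 0 < v i) ∧ v ᵥ* M = 0 := by
  rcases isEmpty_or_nonempty (Fin n) with hn | hn
  · exact ⟨0, fun i => isEmptyElim i, Subsingleton.elim _ _⟩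
  obtain ⟨v, ⟨hv0, hv1⟩, hvM⟩ := h.exists_mem_stdSimplex
  obtain ⟨hZ, s, B, hB, hM, hs⟩ := h
  have hv : ∀ i, 0 < v i := hirr.pos_of_vecMul_nonneg hZ hv0
    (fun h0 => by simp [h0] at hv1) hvM
  refine ⟨v, hv, ?_⟩
  by_contra hne
  obtain ⟨j, hj⟩ := Function.ne_iff.1 hne
  refine not_inversePositive_specRadius_smul_one_sub hB (hs ▸ hM ▸
    inversePositive_of_vecMul_nonneg hZ hv hvM fun S hS => ?_)
  by_cases hu : S = Finset.univ
  · exact ⟨j, hu ▸ Finset.mem_univ j, Or.inl ((hvM j).lt_of_ne' hj)⟩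
  · obtain ⟨k, hk, i, hi, hik⟩ := hirr.exists_ne_zero hS hu
    exact ⟨k, hk, Or.inr ⟨i, hi, hik⟩⟩

/-! ### Inverse positivity of the Newton matrices -/

lemma sign_le_one (r : ℝ) : Real.sign r ≤ 1 := by
  rcases Real.sign_apply_eq r with h | h | h <;> rw [h] <;> norm_num

lemma sub_signDiag_apply_ne (A : Matrix (Fin n) (Fin n) ℝ) (x : Fin n → ℝ) {i j : Fin n}
    (hij : i ≠ j) : (A - signDiag x) i j = (A - 1) i j := by
  simp [signDiag, diagonal_apply_ne _ hij, one_apply_ne hij]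

lemma isZMatrix_sub_signDiag {A : Matrix (Fin n) (Fin n) ℝ} (hZ : IsZMatrix (A - 1))
    (x : Fin n → ℝ) : IsZMatrix (A - signDiag x) := fun i j hij => by
  rw [sub_signDiag_apply_ne A x hij]
  exact hZ i j hij

lemma vecMul_sub_signDiag (A : Matrix (Fin n) (Fin n) ℝ) (x v : Fin n → ℝ) (j : Fin n) :
    (v ᵥ* (A - signDiag x)) j = (v ᵥ* (A - 1)) j + v j * (1 - Real.sign (x j)) := by
  simp only [vecMul_sub, vecMul_one, signDiag, Pi.sub_apply, vecMul_diagonal]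
  ring

lemma IsNonsingularMMatrix.inversePositive_sub_signDiag {A : Matrix (Fin n) (Fin n) ℝ}
    (h : IsNonsingularMMatrix (A - 1)) (x : Fin n → ℝ) : InversePositive (A - signDiag x) := by
  obtain ⟨hZ, s, B, hB, hM, hs⟩ := h
  have hip : InversePositive (A - 1) := hM ▸ inversePositive_smul_one_sub hB hs
  obtain ⟨v, hv, hvM⟩ := hip.exists_pos_vecMul_eq_one hZ
  have hpos : ∀ j, 0 < (v ᵥ* (A - signDiag x)) j := fun j => by
    rw [vecMul_sub_signDiag, hvM]
    exact add_pos_of_pos_of_nonneg zero_lt_one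
      (mul_nonneg (hv j).le (sub_nonneg.2 (sign_le_one _)))
  exact inversePositive_of_vecMul_nonneg (isZMatrix_sub_signDiag hZ x) hv (fun j => (hpos j).le)
    fun S ⟨j, hj⟩ => ⟨j, hj, Or.inl (hpos j)⟩

lemma IsIrreducible.inversePositive_sub_signDiag {A : Matrix (Fin n) (Fin n) ℝ}
    (h : IsIrreducible (A - 1)) (hZ : IsZMatrix (A - 1)) {v : Fin n → ℝ} (hv : ∀ i, 0 < v i)
    (hvM : v ᵥ* (A - 1) = 0) {x : Fin n → ℝ} {j : Fin n} (hj : x j ≤ 0) :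
    InversePositive (A - signDiag x) := by
  have hval : ∀ k, (v ᵥ* (A - signDiag x)) k = v k * (1 - Real.sign (x k)) := fun k => by
    rw [vecMul_sub_signDiag, hvM]
    simp
  refine inversePositive_of_vecMul_nonneg (isZMatrix_sub_signDiag hZ x) hv
    (fun k => (hval k).symm ▸ mul_nonneg (hv k).le (sub_nonneg.2 (sign_le_one _))) fun S hS => ?_
  by_cases hu : S = Finset.univ
  · refine ⟨j, hu ▸ Finset.mem_univ j, Or.inl ?_⟩
    rw [hval]
    refine mul_pos (hv j) ?_
    rcases hj.lt_or_eq with hj | hj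
    · rw [Real.sign_of_neg hj]
      norm_num
    · rw [hj, Real.sign_zero]
      norm_num
  · obtain ⟨k, hk, i, hi, hik⟩ := h.exists_ne_zero hS hu
    exact ⟨k, hk, Or.inr ⟨i, hi, by
      rwa [sub_signDiag_apply_ne A x (ne_of_mem_of_not_mem hk hi).symm]⟩⟩

/-! ### Finite termination -/

lemma sub_signDiag_mulVec (A : Matrix (Fin n) (Fin n) ℝ) (x y : Fin n → ℝ) (i : Fin n) :
    ((A - signDiag x) *ᵥ y) i = (A *ᵥ y) i - Real.sign (x i) * y i := by
  simp [sub_mulVec, signDiag, mulVec_diagonal]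

lemma sign_mul_le_abs (r t : ℝ) : Real.sign r * t ≤ |t| := by
  rcases Real.sign_apply_eq r with h | h | h <;> rw [h]
  · simpa using neg_le_abs t
  · simp
  · simpa using le_abs_self t

lemma sign_mul_self_eq_abs (r : ℝ) : Real.sign r * r = |r| := by
  rcases lt_trichotomy r 0 with h | h | h
  · rw [Real.sign_of_neg h, abs_of_neg h, neg_one_mul]
  · simp [h]
  · rw [Real.sign_of_pos h, abs_of_pos h, one_mul]

lemma sub_signDiag_mulVec_self (A : Matrix (Fin n) (Fin n) ℝ) (x : Fin n → ℝ) :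
    (A - signDiag x) *ᵥ x = A *ᵥ x - fun i => |x i| := by
  funext i
  rw [sub_signDiag_mulVec, sign_mul_self_eq_abs]
  rfl

/-- If all Newton matrices are inverse positive and the iterates from the first on have at most `p`
positive components, the method terminates within `p + 2` iterations. -/
lemma gnmTerminatesWithin_of_inversePositive {A : Matrix (Fin n) (Fin n) ℝ} {b x₀ : Fin n → ℝ}
    {p : ℕ} (hip : ∀ k, InversePositive (A - signDiag (gnm A b x₀ k)))
    (hp : ∀ k, (Finset.univ.filter fun j => 0 < gnm A b x₀ (k + 1) j).card ≤ p) :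
    GNMTerminatesWithin A b x₀ (p + 2) := by
  set x := gnm A b x₀
  have hstep : ∀ k, (A - signDiag (x k)) *ᵥ x (k + 1) = b := fun k =>
    (hip k).mulVec_inv_mulVec b
  have hmono : ∀ k j, x (k + 1) j ≤ x (k + 2) j := fun k j => by
    refine (hip (k + 1)).le_of_mulVec_le (fun i => ?_) j
    rw [hstep (k + 1), ← congrFun (hstep k) i, sub_signDiag_mulVec, sub_signDiag_mulVec,
      sign_mul_self_eq_abs]
    linarith [sign_mul_le_abs (x k i) (x (k + 1) i)]
  have hfix : ∀ k, IsSolution A b (x k) → x (k + 1) = x k := fun k hk => by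
    have h1 : (A - signDiag (x k)) *ᵥ x k = b := (sub_signDiag_mulVec_self A _).trans hk
    funext i
    exact le_antisymm ((hip k).le_of_mulVec_le (fun i => by rw [h1, hstep]) i)
      ((hip k).le_of_mulVec_le (fun i => by rw [h1, hstep]) i)
  have hgrow : ∀ k, ¬ IsSolution A b (x (k + 2)) →
      (Finset.univ.filter fun j => 0 < x (k + 1) j) ⊂
        Finset.univ.filter fun j => 0 < x (k + 2) j := by
    intro k hk
    refine Finset.ssubset_iff_subset_ne.2 ⟨fun j hj => ?_, fun heq => hk ?_⟩
    · simp only [Finset.mem_filter, Finset.mem_univ, true_and] at hj ⊢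
      exact hj.trans_le (hmono k j)
    -- With equal sets of positive components, `D(xᵏ⁺¹)xᵏ⁺² = |xᵏ⁺²|`: a negative component of
    -- `xᵏ⁺²` was already negative in `xᵏ⁺¹`, and a zero component does not matter.
    · refine Eq.trans (funext fun i => ?_) (hstep (k + 1))
      rw [sub_signDiag_mulVec, Pi.sub_apply]
      congr 1
      have hiff : 0 < x (k + 1) i ↔ 0 < x (k + 2) i := by
        simpa using congrArg (i ∈ ·) heq
      rcases lt_trichotomy (x (k + 2) i) 0 with h | h | h
      · rw [Real.sign_of_neg ((hmono k i).trans_lt h), abs_of_neg h, neg_one_mul]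
      · simp [h]
      · rw [Real.sign_of_pos (hiff.2 h), abs_of_pos h, one_mul]
  have hsol : ∃ k ≤ p + 2, IsSolution A b (x k) := by
    by_contra! hno
    have hcard : ∀ m ≤ p + 1, m ≤ (Finset.univ.filter fun j => 0 < x (m + 1) j).card := by
      intro m
      induction m with
      | zero => exact fun _ => Nat.zero_le _
      | succ m ih =>
        intro hm
        have := Finset.card_lt_card (hgrow m (hno (m + 2) (by omega)))
        exact (ih (by omega)).trans_lt this
    have := (hcard (p + 1) le_rfl).trans (hp (p + 1))
    omega
  obtain ⟨k, hk, hks⟩ := hsol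
  refine ⟨fun i => (hip i).isUnit, k, hk, hks, fun i hi => ?_⟩
  induction i, hi using Nat.le_induction with
  | base => rfl
  | succ i _ ih => exact (hfix i (by rwa [← show x i = x k from ih] at hks)).trans ih

lemma exists_nonpos_of_signDiag_ne_one {x : Fin n → ℝ} (h : signDiag x ≠ 1) : ∃ j, x j ≤ 0 := by
  by_contra! hpos
  refine h ?_
  rw [signDiag, ← diagonal_one]
  exact congrArg diagonal (funext fun i => Real.sign_of_pos (hpos i))

lemma exists_neg_of_dotProduct_neg {A : Matrix (Fin n) (Fin n) ℝ} {v b x y : Fin n → ℝ}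
    (hv : ∀ i, 0 < v i) (hvM : v ᵥ* (A - 1) = 0) (hvb : v ⬝ᵥ b < 0)
    (hy : (A - signDiag x) *ᵥ y = b) : ∃ j, y j < 0 := by
  by_contra! hnn
  rw [← hy, dotProduct_mulVec] at hvb
  refine absurd hvb (not_lt.2 (Finset.sum_nonneg fun j _ => mul_nonneg ?_ (hnn j)))
  rw [vecMul_sub_signDiag, hvM, Pi.zero_apply, zero_add]
  exact mul_nonneg (hv j).le (sub_nonneg.2 (sign_le_one _))

lemma gnmTerminatesWithin_of_isIrreducible {A : Matrix (Fin n) (Fin n) ℝ}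
    (h : IsIrreducible (A - 1)) (hZ : IsZMatrix (A - 1)) {v b x₀ : Fin n → ℝ}
    (hv : ∀ i, 0 < v i) (hvM : v ᵥ* (A - 1) = 0) (hvb : v ⬝ᵥ b < 0) (hx₀ : signDiag x₀ ≠ 1) :
    GNMTerminatesWithin A b x₀ (n + 1) := by
  have hnonpos : ∀ k, ∃ j, gnm A b x₀ k j ≤ 0 := by
    intro k
    induction k with
    | zero => exact exists_nonpos_of_signDiag_ne_one hx₀
    | succ k ih =>
      obtain ⟨j, hj⟩ := ih
      obtain ⟨i, hi⟩ := exists_neg_of_dotProduct_neg hv hvM hvb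
        ((h.inversePositive_sub_signDiag hZ hv hvM hj).mulVec_inv_mulVec b)
      exact ⟨i, hi.le⟩
  obtain ⟨j₀, -⟩ := hnonpos 0
  -- An index exists, so `n - 1` is not truncated.
  have hn : n + 1 = n - 1 + 2 := by have := j₀.pos; omega
  rw [hn]
  refine gnmTerminatesWithin_of_inversePositive (fun k => ?_) fun k => Nat.le_sub_one_of_lt ?_
  · obtain ⟨j, hj⟩ := hnonpos k
    exact h.inversePositive_sub_signDiag hZ hv hvM hj
  · obtain ⟨j, hj⟩ := hnonpos (k + 1)
    have : (Finset.univ.filter fun j => 0 < gnm A b x₀ (k + 1) j) ⊂ Finset.univ :=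
      Finset.ssubset_univ_iff.2 fun hu =>
        absurd (by simpa using Finset.ext_iff.1 hu j) (not_lt.2 hj)
    simpa using Finset.card_lt_card this

lemma transpose_sub_one_mulVec (A : Matrix (Fin n) (Fin n) ℝ) (v : Fin n → ℝ) :
    (A.transpose - 1) *ᵥ v = v ᵥ* (A - 1) := by
  rw [← mulVec_transpose, transpose_sub, transpose_one]

end AVE

theorem mainTheorem3 {n : ℕ} (A : Matrix (Fin n) (Fin n) ℝ) :
    (AVE.IsNonsingularMMatrix (A - 1) →
      ∀ b x₀ : Fin n → ℝ, AVE.GNMTerminatesWithin A b x₀ (n + 2)) ∧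
    (AVE.IsIrreducible (A - 1) → AVE.IsSingularMMatrix (A - 1) →
      (∃ v : Fin n → ℝ, (∀ i, 0 < v i) ∧ (A.transpose - 1).mulVec v = 0 ∧
        ∀ w : Fin n → ℝ, (A.transpose - 1).mulVec w = 0 → ∃ c : ℝ, w = c • v) ∧
      ∀ v : Fin n → ℝ, (∀ i, 0 < v i) → (A.transpose - 1).mulVec v = 0 →
        ∀ b x₀ : Fin n → ℝ, v ⬝ᵥ b < 0 → AVE.signDiag x₀ ≠ 1 →
          AVE.GNMTerminatesWithin A b x₀ (n + 1)) := by
  refine ⟨fun h b x₀ => AVE.gnmTerminatesWithin_of_inversePositive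
    (fun k => h.inversePositive_sub_signDiag _) (fun k => ?_), fun hirr h => ?_⟩
  · simpa using Finset.card_le_univ (Finset.univ.filter fun j => 0 < AVE.gnm A b x₀ (k + 1) j)
  simp only [AVE.transpose_sub_one_mulVec]
  refine ⟨?_, fun v hv hvM b x₀ hvb hx₀ =>
    AVE.gnmTerminatesWithin_of_isIrreducible hirr h.1 hv hvM hvb hx₀⟩
  obtain ⟨v, hv, hvM⟩ := h.exists_pos_vecMul_eq_zero hirr
  exact ⟨v, hv, hvM, fun w hw => hirr.exists_eq_smul h.1 hv hvM hw⟩
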